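/- Let $G$ be a finite nonempty DAG (the base network), let $N\ge 1$, and let $R$ be a set of roots of $G$. The $N$-world network $G^N$ replaces each variable $X\notin R$ by copies $X^1,\dots,X^N$ and keeps each variable of $R$ once; for every edge $P\to X$ of $G$ it has the edges $P\to X^i$ $(1\le i\le N)$ if $P\in R$, and $P^i\to X^i$ $(1\le i\le N)$ if $P\notin R$. (1) *Treewidth.* The treewidth of a DAG is the minimum, over all elimination orders of its moral graph, of the size of the largest cluster (the eliminated variable together with its neighbours just before its elimination) minus $1$. If $w$ and $w^t$ are the treewidths of $G$ and $G^N$, then $$w^t\le N(w+1)-1 .$$ (2) *Causal treewidth.* Let $F$ be a set of functional variables of $G$ with $F\cap R=\emptyset$ (functional variables are determined by their parents, so shared roots are not functional), and let the functional variables of $G^N$ be the copies of those in $F$. A jointree of a DAG is a finite tree in which exactly the leaves (nodes with one neighbour) host families (a variable together with its parents): each leaf hosts exactly one family, and each family is hosted by at least one leaf. The separator $S_{ij}$ of an edge $(i,j)$ is the set of variables hosted on both sides of the edge. The cluster of a leaf is its family, the cluster of any other node is the union of its adjacent separators, and the width is the size of the largest cluster minus $1$. A thinned jointree is obtained by applying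 the following rules to exhaustion. A functional variable $X$ may be removed from $S_{ij}$ (i) if $(i,j)$ lies on the path between two leaves hosting the family of $X$ and every separator on that path contains $X$; or (ii) if one of the ends of $(i,j)$ is a non-leaf none of whose other separators contains $X$. The causal treewidth is the minimum width of a thinned jointree, over jointrees of arbitrary size or, in the size-restricted version, over jointrees whose number of nodes is at most a given polynomial in the number of variables of the network (with value $\infty$ if there is none). If $w$ and $w^t$ are the causal treewidths of $G$ and $G^N$, then $$w^t\le N(w+1)-1$$ holds for jointrees of arbitrary size, and also for jointrees of polynomial size in the following sense: for every polynomial $p$ with natural coefficients there is such a polynomial $q$, depending only on $p$, such that the inequality holds for all $G,R,F,N$ as above when $w$ is taken over jointrees of $G$ with at most $p(|G|)$ nodes and $w^t$ over jointrees of $G^N$ with at most $q(|G^N|)$ nodes, where $|\cdot|$ is the number of variables. -/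

import Mathlib

universe u

/-- A directed acyclic graph on the variables `V`; `Edge P X` says that `P` is a parent of `X`. -/
structure DAG (V : Type u) where
  Edge : V → V → Prop
  acyclic : ∀ X, ¬ Relation.TransGen Edge X X

/-- Eliminating the vertex `v` from an undirected graph: every two neighbours of `v` are connected
and `v` is removed. (The vertex type is kept, so `v` stays as an isolated vertex, which does not
influence the neighbourhoods of the remaining vertices.) -/
def SimpleGraph.eliminate {V : Type u} (H : SimpleGraph V) (v : V) : SimpleGraph V where
  Adj x y := x ≠ v ∧ y ≠ v ∧ x ≠ y ∧ (H.Adj x y ∨ (H.Adj x v ∧ H.Adj v y))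
  symm := ⟨fun _ _ h => ⟨h.2.1, h.1, h.2.2.1.symm,
    h.2.2.2.imp (fun e => e.symm) (fun e => ⟨e.2.symm, e.1.symm⟩)⟩⟩
  loopless := ⟨fun _ h => h.2.2.1 rfl⟩

/-- The clusters induced by eliminating the vertices of a list one after the other: each cluster
consists of the eliminated vertex and its neighbours just before its elimination. -/
def SimpleGraph.clusterSequence {V : Type u} (H : SimpleGraph V) : List V → List (Set V)
  | [] => []
  | v :: l => insert v (H.neighborSet v) :: (H.eliminate v).clusterSequence l

namespace DAG

variable {V : Type u}

/-- A root is a variable without parents. -/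
def IsRoot (G : DAG V) (X : V) : Prop := ∀ P, ¬ G.Edge P X

/-- The family of a variable: the variable and its parents. -/
def family (G : DAG V) (X : V) : Set V := insert X {P | G.Edge P X}

/-- The moral graph: directions are dropped and common parents are connected. -/
def moralGraph (G : DAG V) : SimpleGraph V where
  Adj X Y := X ≠ Y ∧ (G.Edge X Y ∨ G.Edge Y X ∨ ∃ Z, G.Edge X Z ∧ G.Edge Y Z)
  symm := ⟨fun _ _ h => ⟨h.1.symm, by
    rcases h.2 with e | e | ⟨Z, e, f⟩
    · exact Or.inr (Or.inl e)
    · exact Or.inl e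
    · exact Or.inr (Or.inr ⟨Z, f, e⟩)⟩⟩
  loopless := ⟨fun _ h => h.1 rfl⟩

/-- An elimination order: a list in which every variable occurs exactly once. -/
def IsElimOrder (π : List V) : Prop := π.Nodup ∧ ∀ X, X ∈ π

/-- The width of an elimination order: the size of its largest cluster, minus one. -/
noncomputable def elimWidth (G : DAG V) (π : List V) : ℕ :=
  ((G.moralGraph.clusterSequence π).map Set.ncard).foldr max 0 - 1

/-- The treewidth of a DAG: the minimum width of an elimination order. -/
noncomputable def treewidth (G : DAG V) : ℕ :=
  sInf {w | ∃ π : List V, IsElimOrder π ∧ G.elimWidth π = w}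

/-- A jointree for `G`: a finite tree whose leaves (the nodes with exactly one neighbour) host the
families of `G`. The set `hosts X` consists of the nodes that host the family of `X`. -/
structure Jointree (G : DAG V) where
  size : ℕ
  tree : SimpleGraph (Fin size)
  isTree : tree.IsTree
  hosts : V → Set (Fin size)
  /-- Only leaves are hosts. -/
  leaf_of_mem_hosts : ∀ X i, i ∈ hosts X → ∃! j, tree.Adj i j
  /-- Every leaf hosts exactly one family. -/
  existsUnique_of_leaf : ∀ i, (∃! j, tree.Adj i j) → ∃! X, i ∈ hosts X
  /-- Every family has a host. -/
  hosts_nonempty : ∀ X, (hosts X).Nonempty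

namespace Jointree

variable {G : DAG V}

/-- A leaf is a tree node with a single neighbour. -/
def IsLeaf (J : G.Jointree) (i : Fin J.size) : Prop := ∃! j, J.tree.Adj i j

/-- The classical separators: the separator of an edge `e` is the set of all variables that are
hosted (as members of hosted families) on both sides of `e`. Pairs that are no edges get `∅`. -/
def sep (J : G.Jointree) (e : Sym2 (Fin J.size)) : Set V :=
  {Y | e ∈ J.tree.edgeSet ∧ ∀ i ∈ e, ∃ l X,
    (J.tree.deleteEdges {e}).Reachable i l ∧ l ∈ J.hosts X ∧ Y ∈ G.family X}

/-- The cluster of a node for an assignment `S` of separators to the edges: the hosted family for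
a leaf, and the union of the adjacent separators for every other node. -/
def cluster (J : G.Jointree) (S : Sym2 (Fin J.size) → Set V) (i : Fin J.size) : Set V :=
  {Y | (J.IsLeaf i ∧ ∃ X, i ∈ J.hosts X ∧ Y ∈ G.family X) ∨
    (¬ J.IsLeaf i ∧ ∃ j, J.tree.Adj i j ∧ Y ∈ S s(i, j))}

/-- The width: the size of the largest cluster, minus one. -/
noncomputable def width (J : G.Jointree) (S : Sym2 (Fin J.size) → Set V) : ℕ :=
  (Finset.univ.sup fun i => (J.cluster S i).ncard) - 1

/-- Condition of the first thinning rule: the edge `e` is on the path between two leaves that host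
the family of `X`, and every separator on that path contains `X`. -/
def Rule1 (J : G.Jointree) (S : Sym2 (Fin J.size) → Set V) (X : V) (e : Sym2 (Fin J.size)) :
    Prop :=
  ∃ l ∈ J.hosts X, ∃ r ∈ J.hosts X, ∃ p : J.tree.Walk l r,
    p.IsPath ∧ e ∈ p.edges ∧ ∀ e' ∈ p.edges, X ∈ S e'

/-- Condition of the second thinning rule: at some end `i` of the edge `e`, an internal node of the
tree, no other separator adjacent to `i` contains `X`. -/
def Rule2 (J : G.Jointree) (S : Sym2 (Fin J.size) → Set V) (X : V) (e : Sym2 (Fin J.size)) :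
    Prop :=
  ∃ i ∈ e, ¬ J.IsLeaf i ∧ ∀ k, J.tree.Adj i k → s(i, k) ≠ e → X ∉ S s(i, k)

/-- One thinning step: one of the two rules removes a functional variable from one separator. -/
def ThinStep (J : G.Jointree) (F : Set V) (S S' : Sym2 (Fin J.size) → Set V) : Prop :=
  ∃ X ∈ F, ∃ e ∈ J.tree.edgeSet, X ∈ S e ∧ (J.Rule1 S X e ∨ J.Rule2 S X e) ∧
    S' = Function.update S e (S e \ {X})

/-- `S` is a family of thinned separators of `J`: it is obtained from the classical separators by
applying the thinning rules to exhaustion. -/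
def IsThinned (J : G.Jointree) (F : Set V) (S : Sym2 (Fin J.size) → Set V) : Prop :=
  Relation.ReflTransGen (J.ThinStep F) J.sep S ∧ ∀ S', ¬ J.ThinStep F S S'

end Jointree

/-- The causal treewidth of `G` with functional variables `F`, under the bound `b` on the number of
jointree nodes: the minimum width of a thinned jointree with at most `b` nodes (`⊤` if there is
none). For `b = ⊤` the size of the jointree is unrestricted. -/
noncomputable def causalTreewidth (G : DAG V) (F : Set V) (b : ℕ∞) : ℕ∞ :=
  ⨅ (J : G.Jointree) (S : Sym2 (Fin J.size) → Set V) (_ : J.IsThinned F S)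
    (_ : (J.size : ℕ∞) ≤ b), (J.width S : ℕ∞)

/-- The variables of the `N`-world network: the variables of `R`, which are shared, and `N` copies
`(X, 1), …, (X, N)` of every other variable `X`. -/
abbrev NWorldVar (R : Set V) (N : ℕ) : Type u := ↥R ⊕ (↥Rᶜ × Fin N)

/-- The base variable of which a variable of the `N`-world network is a copy. -/
def NWorldVar.base {R : Set V} {N : ℕ} : NWorldVar R N → V
  | Sum.inl X => X.1
  | Sum.inr Xi => Xi.1.1

/-- The edges of the `N`-world network: a parent in `R` of `X` is a parent of every copy of `X`, and
copy `j` of a parent outside `R` is a parent of copy `j` of `X`. -/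
def NWorldEdge (G : DAG V) (R : Set V) (N : ℕ) : NWorldVar R N → NWorldVar R N → Prop
  | Sum.inl P, Sum.inr (X, _) => G.Edge P.1 X.1
  | Sum.inr (P, j), Sum.inr (X, i) => j = i ∧ G.Edge P.1 X.1
  | _, Sum.inl _ => False

/-- The `N`-world network of `G` with shared variables `R` (a set of roots of `G`). -/
def nWorld (G : DAG V) (R : Set V) (N : ℕ) : DAG (NWorldVar R N) where
  Edge := G.NWorldEdge R N
  acyclic := by
    have h : ∀ a b, G.NWorldEdge R N a b → G.Edge a.base b.base := by
      rintro (P | ⟨P, j⟩) (X | ⟨X, i⟩) e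
      · exact e.elim
      · exact e
      · exact e.elim
      · exact e.2
    intro X hX
    exact G.acyclic _ (Relation.TransGen.lift NWorldVar.base h _ _ hX)

end DAG

/-! ### Elimination orders and projections. -/

namespace SimpleGraph

/-! Everything is compared along the map `base` from copies to originals, whose fibres have at most
`N` elements. A cluster of the `N`-world network that lies over a cluster of the base network has at
most `N * (w + 1)` elements.

For treewidth, replace each variable of an optimal order by all its copies. Moral edges project to
edges or to single vertices, and this is still so after a whole fibre is eliminated
(`clusterSequence_fiber`, `clusterSequence_flatMap_fiber`).

For causal treewidth, attach to each leaf hosting the family of `X` one new leaf per copy of `X`.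
Separators of old edges become exact preimages (`sep_old`), and each thinning step can be repeated
for all copies of its variable (`rule1`, `rule2`, `exists_mirror`). Completing the thinning only
shrinks separators, so clusters stay over old clusters (`cluster_subset`). The tree grows by a
factor of at most one plus the number of variables of the network, which gives the polynomial
version. -/

theorem clusterSequence_append {V : Type*} (H : SimpleGraph V) (l m : List V) :
    H.clusterSequence (l ++ m) =
      H.clusterSequence l ++ (l.foldl SimpleGraph.eliminate H).clusterSequence m := by
  induction l generalizing H with
  | nil => rfl
  | cons a l ih => simp [clusterSequence, ih]

/-- Eliminating, one after the other, vertices that lie over the same vertex `x`: the clusters lie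
over the cluster of `x`. -/
theorem clusterSequence_fiber {V W : Type*} (b : W → V) (H : SimpleGraph V) (x : V) (l : List W)
    (hl : ∀ u ∈ l, b u = x) (K : SimpleGraph W)
    (hK : ∀ u v, K.Adj u v → b u = b v ∨ H.Adj (b u) (b v) ∨ (H.Adj (b u) x ∧ H.Adj x (b v))) :
    (∀ C ∈ K.clusterSequence l, C ⊆ b ⁻¹' insert x (H.neighborSet x)) ∧
    (∀ u v, (l.foldl SimpleGraph.eliminate K).Adj u v →
      (u ∉ l ∧ v ∉ l) ∧
      (b u = b v ∨ H.Adj (b u) (b v) ∨ (H.Adj (b u) x ∧ H.Adj x (b v)))) := by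
  induction l generalizing K with
  | nil => simpa [clusterSequence] using hK
  | cons a l ih =>
    have ha : b a = x := hl a (by simp)
    -- Since `H` has no loops, a neighbour of `a` lies over `x` or over a neighbour of `x`. So every
    -- fill edge again projects to a point, an edge at `x`, or a fill edge of `x`.
    have hK' : ∀ u v, (K.eliminate a).Adj u v →
        b u = b v ∨ H.Adj (b u) (b v) ∨ (H.Adj (b u) x ∧ H.Adj x (b v)) := by
      rintro u v ⟨-, -, -, h | ⟨h, h'⟩⟩
      · exact hK u v h
      · have h1 := hK _ _ h
        have h2 := hK _ _ h'
        rw [ha] at h1 h2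
        have hx := H.loopless.irrefl x
        grind
    obtain ⟨h1, h2⟩ := ih (fun u hu => hl u (by simp [hu])) (K.eliminate a) hK'
    refine ⟨?_, ?_⟩
    · intro C hC
      rcases List.mem_cons.1 hC with rfl | hC
      · rintro v (rfl | hv)
        · exact Or.inl ha
        · have := hK _ _ hv
          rw [ha] at this
          rcases this with h | h | ⟨h, -⟩
          · exact Or.inl h.symm
          · exact Or.inr h
          · exact (H.loopless.irrefl x h).elim
      · exact h1 C hC
    · intro u v huv
      obtain ⟨h4, h5⟩ := h2 u v huv
      -- Eliminated vertices stay in the vertex type; an isolated vertex remains isolated under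
      -- later eliminations.
      have key : ∀ (l : List W) (K : SimpleGraph W),
          (∀ v, ¬ K.Adj a v) → ∀ v, ¬ (l.foldl SimpleGraph.eliminate K).Adj a v := by
        intro l
        induction l with
        | nil => intro K h; exact h
        | cons c l ih =>
          intro K h
          refine ih _ ?_
          rintro v ⟨-, -, -, e | ⟨e, -⟩⟩
          · exact h _ e
          · exact h _ e
      have hia : ∀ v, ¬ (l.foldl SimpleGraph.eliminate (K.eliminate a)).Adj a v :=
        key l _ (fun v h => h.1 rfl)
      have hua : u ≠ a := by rintro rfl; exact hia _ huv
      have hva : v ≠ a := by rintro rfl; exact hia _ huv.symm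
      refine ⟨?_, h5⟩
      simp [hua, hva, h4.1, h4.2]

/-- Eliminating the fibers of the vertices of a list yields clusters over the clusters of the
list. -/
theorem clusterSequence_flatMap_fiber {V W : Type*} (b : W → V) (c : V → List W)
    (hc : ∀ x u, u ∈ c x ↔ b u = x) (l : List V) (H : SimpleGraph V) (K : SimpleGraph W)
    (hK : ∀ u v, K.Adj u v → b u = b v ∨ H.Adj (b u) (b v)) :
    ∀ C ∈ K.clusterSequence (l.flatMap c), ∃ D ∈ H.clusterSequence l, C ⊆ b ⁻¹' D := by
  induction l generalizing H K with
  | nil => simp [clusterSequence]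
  | cons x l ih =>
    obtain ⟨h1, h2⟩ := clusterSequence_fiber b H x (c x) (fun u hu => (hc x u).1 hu) K
      (fun u v h => (hK u v h).imp_right Or.inl)
    intro C hC
    rw [List.flatMap_cons, clusterSequence_append, List.mem_append] at hC
    rcases hC with hC | hC
    · exact ⟨_, List.mem_cons_self, h1 C hC⟩
    · obtain ⟨D, hD, hCD⟩ := ih (H.eliminate x) _ (fun u v huv => by
        obtain ⟨⟨h4, h5⟩, h6⟩ := h2 u v huv
        rw [hc] at h4 h5
        by_cases hb : b u = b v
        · exact Or.inl hb
        · exact Or.inr ⟨h4, h5, hb, h6.resolve_left hb⟩) C hC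
      exact ⟨D, List.mem_cons_of_mem _ hD, hCD⟩

end SimpleGraph

/-! ### The base map and the treewidth bound. -/

theorem List.foldr_max_le {l : List ℕ} {m : ℕ} : l.foldr max 0 ≤ m ↔ ∀ a ∈ l, a ≤ m := by
  induction l with
  | nil => simp
  | cons a l ih => simp [ih]

namespace DAG

variable {V : Type u} {R : Set V} {N : ℕ}

theorem ncard_base_preimage_le [Finite V] (hN : 1 ≤ N) (A : Set V) :
    ((NWorldVar.base : NWorldVar R N → V) ⁻¹' A).ncard ≤ N * A.ncard := by
  -- Shared variables get the dummy index 0, which keeps the pair (base, index) injective.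
  let j : NWorldVar R N → Fin N := Sum.elim (fun _ => ⟨0, hN⟩) (fun x => x.2)
  have h := Set.ncard_le_ncard_of_injOn (s := (NWorldVar.base : NWorldVar R N → V) ⁻¹' A)
    (t := A ×ˢ (Set.univ : Set (Fin N))) (fun v => (v.base, j v)) (fun v hv => ⟨hv, trivial⟩) (by
      rintro (⟨P, hP⟩ | ⟨⟨P, hP⟩, i⟩) - (⟨Q, hQ⟩ | ⟨⟨Q, hQ⟩, i'⟩) - h <;>
        simp only [Prod.mk.injEq, NWorldVar.base, j, Sum.elim_inl, Sum.elim_inr] at h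
      · simp [h.1]
      · exact absurd (h.1 ▸ hP) hQ
      · exact absurd (h.1 ▸ hQ) hP
      · simp [h.1, h.2])
  rw [Set.ncard_prod, Set.ncard_univ, Nat.card_eq_fintype_card, Fintype.card_fin] at h
  rwa [mul_comm]

theorem edge_base {G : DAG V} {u v : NWorldVar R N} (h : (G.nWorld R N).Edge u v) :
    G.Edge u.base v.base := by
  rcases u with P | ⟨P, j⟩ <;> rcases v with X | ⟨X, i⟩
  · exact h.elim
  · exact h
  · exact h.elim
  · exact h.2

theorem base_surjective (hN : 1 ≤ N) : Function.Surjective (NWorldVar.base : NWorldVar R N → V) :=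
  fun X => by
    by_cases hX : X ∈ R
    · exact ⟨Sum.inl ⟨X, hX⟩, rfl⟩
    · exact ⟨Sum.inr (⟨X, hX⟩, ⟨0, hN⟩), rfl⟩

theorem base_mem_family {G : DAG V} {u v : NWorldVar R N} (h : v ∈ (G.nWorld R N).family u) :
    v.base ∈ G.family u.base := by
  rcases h with rfl | h
  · exact Or.inl rfl
  · exact Or.inr (edge_base h)

/-- This is where the shared variables must be roots: a child of anything is then outside `R`, so it
has a copy with the index of its given parent, and any copy serves if that parent is shared. -/
theorem exists_mem_family_of_base {G : DAG V} (hN : 1 ≤ N) (hR : ∀ X ∈ R, G.IsRoot X)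
    {v : NWorldVar R N} {X : V} (h : v.base ∈ G.family X) :
    ∃ u : NWorldVar R N, u.base = X ∧ v ∈ (G.nWorld R N).family u := by
  rcases h with h | h
  · exact ⟨v, h, Or.inl rfl⟩
  · have hX : X ∉ R := fun hX => hR X hX _ h
    rcases v with P | ⟨P, j⟩
    · exact ⟨Sum.inr (⟨X, hX⟩, ⟨0, hN⟩), rfl, Or.inr h⟩
    · exact ⟨Sum.inr (⟨X, hX⟩, j), rfl, Or.inr ⟨rfl, h⟩⟩

theorem moralGraph_base {G : DAG V} {u v : NWorldVar R N} (h : (G.nWorld R N).moralGraph.Adj u v) :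
    u.base = v.base ∨ G.moralGraph.Adj u.base v.base := by
  by_cases hb : u.base = v.base
  · exact Or.inl hb
  · refine Or.inr ⟨hb, h.2.imp edge_base (Or.imp edge_base ?_)⟩
    rintro ⟨Z, h1, h2⟩
    exact ⟨Z.base, edge_base h1, edge_base h2⟩

theorem exists_isElimOrder_elimWidth_eq_treewidth [Finite V] (G : DAG V) :
    ∃ π : List V, IsElimOrder π ∧ G.elimWidth π = G.treewidth := by
  have := Fintype.ofFinite V
  exact Nat.sInf_mem (s := {w | ∃ π : List V, IsElimOrder π ∧ G.elimWidth π = w})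
    ⟨_, Finset.univ.toList, ⟨Finset.nodup_toList _, by simp⟩, rfl⟩

theorem treewidth_nWorld_le [Finite V] (G : DAG V) (hN : 1 ≤ N) :
    (G.nWorld R N).treewidth ≤ N * (G.treewidth + 1) - 1 := by
  classical
  have := Fintype.ofFinite (NWorldVar R N)
  obtain ⟨π, hπ, hw⟩ := G.exists_isElimOrder_elimWidth_eq_treewidth
  let c : V → List (NWorldVar R N) := fun x => (Finset.univ.filter fun u => u.base = x).toList
  have hc : ∀ x u, u ∈ c x ↔ u.base = x := by simp [c]
  have hord : IsElimOrder (π.flatMap c) := by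
    refine ⟨List.nodup_flatMap.2 ⟨fun x _ => Finset.nodup_toList _, ?_⟩, fun u => ?_⟩
    · refine hπ.1.imp fun {x y} hxy u hu hu' => hxy ?_
      rw [← (hc x u).1 hu, ← (hc y u).1 hu']
    · exact List.mem_flatMap.2 ⟨u.base, hπ.2 _, (hc _ _).2 rfl⟩
  have hle : (G.nWorld R N).treewidth ≤ (G.nWorld R N).elimWidth (π.flatMap c) :=
    Nat.sInf_le ⟨_, hord, rfl⟩
  refine hle.trans (Nat.sub_le_sub_right (List.foldr_max_le.2 ?_) 1)
  intro a ha
  obtain ⟨C, hC, rfl⟩ := List.mem_map.1 ha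
  obtain ⟨D, hD, hCD⟩ := SimpleGraph.clusterSequence_flatMap_fiber NWorldVar.base c hc π
    G.moralGraph (G.nWorld R N).moralGraph (fun u v h => moralGraph_base h) C hC
  calc C.ncard ≤ _ := Set.ncard_le_ncard hCD
    _ ≤ N * D.ncard := ncard_base_preimage_le hN D
    _ ≤ N * (G.treewidth + 1) := by
      have h := List.foldr_max_le.1 le_rfl _ (List.mem_map_of_mem (f := Set.ncard) hD)
      have h2 : G.elimWidth π = _ - 1 := rfl
      -- The maximum is at most its truncated predecessor plus one, even when it is 0.
      gcongr
      omega

end DAG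

/-! ### Attaching leaves to a tree. -/

namespace SimpleGraph

variable {A B L : Type*}

/-- `T'` arises from `T` by attaching new leaves: `o` embeds the vertices of `T`, `n` enumerates the
new leaves, and `c` maps every new leaf to the vertex it is attached to. -/
structure IsLeafExtension (T : SimpleGraph A) (T' : SimpleGraph B) (o : A → B) (n : L → B)
    (c : B → A) : Prop where
  collapse_old : ∀ a, c (o a) = a
  cover : ∀ b, (∃ a, b = o a) ∨ ∃ x, b = n x
  old_ne_new : ∀ a x, o a ≠ n x
  new_injective : Function.Injective n
  adj_old : ∀ a b, T'.Adj (o a) (o b) ↔ T.Adj a b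
  adj_new : ∀ x b, T'.Adj (n x) b ↔ b = o (c (n x))

namespace IsLeafExtension

variable {T : SimpleGraph A} {T' : SimpleGraph B} {o : A → B} {n : L → B} {c : B → A}

theorem old_injective (h : T.IsLeafExtension T' o n c) : Function.Injective o :=
  Function.LeftInverse.injective h.collapse_old

theorem map_injective (h : T.IsLeafExtension T' o n c) : Function.Injective (Sym2.map o) :=
  Sym2.map.injective h.old_injective

theorem map_ne_new (h : T.IsLeafExtension T' o n c) (e : Sym2 A) (x : L) (b : B) :
    e.map o ≠ s(n x, b) := by
  intro he
  have : n x ∈ e.map o := he ▸ Sym2.mem_mk_left _ _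
  obtain ⟨a, -, ha⟩ := Sym2.mem_map.1 this
  exact h.old_ne_new a x ha

theorem map_mem_edgeSet (h : T.IsLeafExtension T' o n c) (e : Sym2 A) :
    e.map o ∈ T'.edgeSet ↔ e ∈ T.edgeSet := by
  induction e with
  | h a b => simpa using h.adj_old a b

theorem adj_new_old (h : T.IsLeafExtension T' o n c) (x : L) : T'.Adj (n x) (o (c (n x))) :=
  (h.adj_new x _).2 rfl

theorem edge_cases (h : T.IsLeafExtension T' o n c) {a b : B} (hab : T'.Adj a b) :
    (∃ a' b', a = o a' ∧ b = o b' ∧ T.Adj a' b') ∨ (∃ x, a = n x ∧ b = o (c (n x))) ∨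
      ∃ x, b = n x ∧ a = o (c (n x)) := by
  rcases h.cover a with ⟨a', rfl⟩ | ⟨x, rfl⟩
  · rcases h.cover b with ⟨b', rfl⟩ | ⟨x, rfl⟩
    · exact Or.inl ⟨a', b', rfl, rfl, (h.adj_old _ _).1 hab⟩
    · exact Or.inr (Or.inr ⟨x, rfl, (h.adj_new _ _).1 hab.symm⟩)
  · exact Or.inr (Or.inl ⟨x, rfl, (h.adj_new _ _).1 hab⟩)

/-- Contracting the new leaves sends each edge to itself or to a point, so a walk avoiding `e`
projects to one avoiding `e`. -/
theorem reachable_collapse (h : T.IsLeafExtension T' o n c) {e : Sym2 A} {a b : B}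
    (hab : (T'.deleteEdges {e.map o}).Reachable a b) :
    (T.deleteEdges {e}).Reachable (c a) (c b) := by
  rw [reachable_iff_reflTransGen] at hab
  induction hab with
  | refl => rfl
  | tail _ hbc ih =>
    refine ih.trans ?_
    rw [deleteEdges_adj] at hbc
    rcases h.edge_cases hbc.1 with ⟨a', b', rfl, rfl, hadj⟩ | ⟨x, rfl, rfl⟩ | ⟨x, rfl, rfl⟩
    · rw [h.collapse_old, h.collapse_old]
      refine Adj.reachable (deleteEdges_adj.2 ⟨hadj, fun he => hbc.2 ?_⟩)
      rw [Set.mem_singleton_iff] at he ⊢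
      rw [← he, Sym2.map_mk]
    · rw [h.collapse_old]
    · rw [h.collapse_old]

theorem reachable_old (h : T.IsLeafExtension T' o n c) {e : Sym2 A} {a b : A}
    (hab : (T.deleteEdges {e}).Reachable a b) :
    (T'.deleteEdges {e.map o}).Reachable (o a) (o b) := by
  refine hab.map ⟨o, fun {a b} hadj => ?_⟩
  rw [deleteEdges_adj] at hadj ⊢
  refine ⟨(h.adj_old a b).2 hadj.1, fun he => hadj.2 ?_⟩
  exact h.map_injective (by simpa using he)

theorem reachable_new (h : T.IsLeafExtension T' o n c) (e : Sym2 A) (x : L) :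
    (T'.deleteEdges {e.map o}).Reachable (o (c (n x))) (n x) := by
  refine Adj.reachable (deleteEdges_adj.2 ⟨(h.adj_new_old x).symm, fun he => ?_⟩)
  rw [Set.mem_singleton_iff, Sym2.eq_swap] at he
  exact h.map_ne_new e x _ he.symm

/-- Cutting the edge of a new leaf isolates the leaf. -/
theorem eq_of_reachable_new (h : T.IsLeafExtension T' o n c) {x : L} {b : B}
    (hb : (T'.deleteEdges {s(n x, o (c (n x)))}).Reachable (n x) b) : b = n x := by
  rw [reachable_iff_reflTransGen] at hb
  induction hb with
  | refl => rfl
  | tail _ hbc ih =>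
    subst ih
    rw [deleteEdges_adj] at hbc
    obtain rfl := (h.adj_new _ _).1 hbc.1
    exact (hbc.2 rfl).elim

theorem reachable_old_of_new (h : T.IsLeafExtension T' o n c) (hT : T.Connected) (x : L) (a b : A) :
    (T'.deleteEdges {s(n x, o (c (n x)))}).Reachable (o a) (o b) := by
  refine (hT.preconnected a b).map ⟨o, fun {a b} hadj => ?_⟩
  rw [deleteEdges_adj]
  exact ⟨(h.adj_old a b).2 hadj, fun he => h.map_ne_new s(a, b) x _ he⟩

/-- Acyclicity is checked edgewise: an old edge is a bridge by collapsing, a new one because cutting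
it isolates its leaf. -/
theorem isTree (h : T.IsLeafExtension T' o n c) (hT : T.IsTree) : T'.IsTree := by
  have hc : ∀ b, T'.Reachable (o (c b)) b := by
    intro b
    rcases h.cover b with ⟨a, rfl⟩ | ⟨x, rfl⟩
    · rw [h.collapse_old]
    · exact (h.adj_new_old x).symm.reachable
  have ho : ∀ a b, T'.Reachable (o a) (o b) := fun a b =>
    (hT.connected.preconnected a b).map ⟨o, fun {a b} hadj => (h.adj_old a b).2 hadj⟩
  have : Nonempty B := hT.connected.nonempty.map o
  refine ⟨⟨fun a b => ((hc a).symm.trans (ho _ _)).trans (hc b)⟩, ?_⟩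
  rw [isAcyclic_iff_forall_adj_isBridge]
  intro a b hab
  have new : ∀ x, T'.IsBridge s(n x, o (c (n x))) := fun x hr =>
    h.old_ne_new _ _ (h.eq_of_reachable_new hr)
  rcases h.edge_cases hab with ⟨a', b', rfl, rfl, hadj⟩ | ⟨x, rfl, rfl⟩ | ⟨x, rfl, rfl⟩
  · intro hr
    have := h.reachable_collapse (e := s(a', b')) hr
    rw [h.collapse_old, h.collapse_old] at this
    exact isAcyclic_iff_forall_adj_isBridge.1 hT.isAcyclic hadj this
  · exact new x
  · rw [Sym2.eq_swap]
    exact new x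

theorem existsUnique_adj_new (h : T.IsLeafExtension T' o n c) (x : L) :
    ∃! b, T'.Adj (n x) b :=
  ⟨_, h.adj_new_old x, fun _ hb => (h.adj_new _ _).1 hb⟩

/-- If leaves are attached to all leaves, then no old vertex is a leaf. -/
theorem not_existsUnique_adj_old (h : T.IsLeafExtension T' o n c)
    (hleaf : ∀ a, (∃! b, T.Adj a b) → ∃ x, c (n x) = a)
    (hnew : ∀ x, ∃ b, T.Adj (c (n x)) b) (a : A) : ¬ ∃! b, T'.Adj (o a) b := by
  rintro ⟨b, hb, hu⟩
  have key : ∀ x, c (n x) = a → False := by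
    rintro x rfl
    obtain ⟨d, hd⟩ := hnew x
    have h1 := hu _ ((h.adj_old _ _).2 hd)
    have h2 := hu _ (h.adj_new_old x).symm
    exact h.old_ne_new _ _ (h1.trans h2.symm)
  rcases h.edge_cases hb with ⟨a', b', ha, rfl, hadj⟩ | ⟨x, hx, -⟩ | ⟨x, -, hx⟩
  · obtain rfl := h.old_injective ha
    obtain ⟨x, hx⟩ := hleaf a ⟨b', hadj, fun d hd => h.old_injective (hu _ ((h.adj_old _ _).2 hd))⟩
    exact key x hx
  · exact h.old_ne_new _ _ hx
  · exact key x (h.old_injective hx).symm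

/-- A path between two distinct vertices extends to the new leaves attached to its ends. -/
theorem exists_isPath_new (h : T.IsLeafExtension T' o n c) {x y : L} (hxy : x ≠ y)
    {p : T.Walk (c (n x)) (c (n y))} (hp : p.IsPath) :
    ∃ q : T'.Walk (n x) (n y), q.IsPath ∧ ∀ e, e ∈ q.edges ↔
      e = s(n x, o (c (n x))) ∨ (∃ e' ∈ p.edges, e'.map o = e) ∨ e = s(n y, o (c (n y))) := by
  let f : T →g T' := ⟨o, fun {a b} hadj => (h.adj_old a b).2 hadj⟩
  have hs : ∀ z, n z ∉ (p.map f).support := by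
    intro z hz
    rw [Walk.support_map, List.mem_map] at hz
    obtain ⟨a, -, ha⟩ := hz
    exact h.old_ne_new a z ha
  refine ⟨Walk.cons (h.adj_new_old x) ((p.map f).concat (h.adj_new_old y).symm), ?_, ?_⟩
  · rw [Walk.cons_isPath_iff, Walk.concat_isPath_iff]
    refine ⟨⟨hp.map h.old_injective, hs y⟩, ?_⟩
    rw [Walk.support_concat, List.mem_append, List.mem_singleton]
    rintro (hx | hx)
    · exact hs x hx
    · exact hxy (h.new_injective hx)
  · intro e
    rw [Walk.edges_cons, Walk.edges_concat, Walk.edges_map]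
    simp only [List.mem_cons, List.concat_eq_append, List.mem_append, List.mem_map,
      List.not_mem_nil, or_false]
    rw [Sym2.eq_swap (a := n y)]
    rfl

end IsLeafExtension

/-- Every way of attaching leaves is realized on any vertex type of the right size. -/
theorem exists_isLeafExtension (T : SimpleGraph A) (f : L → A) (ε : A ⊕ L ≃ B) :
    ∃ (T' : SimpleGraph B) (o : A → B) (n : L → B) (c : B → A),
      T.IsLeafExtension T' o n c ∧ ∀ x, c (n x) = f x := by
  let U : SimpleGraph (A ⊕ L) :=
    { Adj := fun a b => Sum.elim
        (fun a => Sum.elim (fun b => T.Adj a b) (fun y => f y = a) b)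
        (fun x => Sum.elim (fun b => f x = b) (fun _ => False) b) a
      symm := ⟨by rintro (a | x) (b | y) h <;> simp_all [T.adj_comm]⟩
      loopless := ⟨by rintro (a | x) <;> simp⟩ }
  refine ⟨U.comap ε.symm, ε ∘ Sum.inl, ε ∘ Sum.inr, Sum.elim id f ∘ ε.symm, ⟨?_, ?_, ?_, ?_, ?_, ?_⟩,
    ?_⟩
  · simp
  · intro b
    obtain ⟨b, rfl⟩ := ε.surjective b
    rcases b with a | x
    · exact Or.inl ⟨a, rfl⟩
    · exact Or.inr ⟨x, rfl⟩
  · simp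
  · exact ε.injective.comp Sum.inr_injective
  · simp [U]
  · intro x b
    obtain ⟨b, rfl⟩ := ε.surjective b
    rcases b with a | y
    · simp [U, eq_comm]
    · simp [U]
  · simp

end SimpleGraph

/-! ### Jointrees of the `N`-world network and generalities on thinning. -/

namespace DAG

variable {V : Type u} {R : Set V} {N : ℕ} {G : DAG V}

namespace Jointree

/-- The leaves attached to a jointree in order to obtain a jointree of the `N`-world network: a host
of the family of `X` gets one leaf for every copy of `X`. -/
abbrev NewLeaf (J : G.Jointree) (R : Set V) (N : ℕ) : Type u :=
  {x : Fin J.size × NWorldVar R N // x.1 ∈ J.hosts x.2.base}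

/-- `J'` arises from `J` by attaching leaves that host the families of the copies. -/
structure IsNWorldExtension (J : G.Jointree) (J' : (G.nWorld R N).Jointree)
    (o : Fin J.size → Fin J'.size) (n : J.NewLeaf R N → Fin J'.size)
    (c : Fin J'.size → Fin J.size) : Prop extends J.tree.IsLeafExtension J'.tree o n c where
  collapse_new : ∀ x, c (n x) = x.1.1
  mem_hosts_iff : ∀ v b, b ∈ J'.hosts v ↔ ∃ x : J.NewLeaf R N, x.1.2 = v ∧ b = n x

theorem exists_mem_hosts_of_isLeaf (J : G.Jointree) (hN : 1 ≤ N) {a : Fin J.size}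
    (ha : J.IsLeaf a) : ∃ x : J.NewLeaf R N, x.1.1 = a := by
  obtain ⟨X, hX, -⟩ := J.existsUnique_of_leaf a ha
  obtain ⟨v, rfl⟩ := base_surjective (R := R) hN X
  exact ⟨⟨(a, v), hX⟩, rfl⟩

/-- Every old leaf hosts a family with at least one copy, so it becomes internal, and the leaves of
the new tree are exactly the attached ones. -/
theorem exists_isNWorldExtension [Finite V] (J : G.Jointree) (hN : 1 ≤ N) :
    ∃ (J' : (G.nWorld R N).Jointree) (o : Fin J.size → Fin J'.size)
      (n : J.NewLeaf R N → Fin J'.size) (c : Fin J'.size → Fin J.size),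
      J.IsNWorldExtension J' o n c ∧ J'.size ≤ J.size * (1 + Nat.card (NWorldVar R N)) := by
  obtain ⟨T', o, n, c, h, hc⟩ := J.tree.exists_isLeafExtension (fun x : J.NewLeaf R N => x.1.1)
    (Finite.equivFin (Fin J.size ⊕ J.NewLeaf R N))
  have hold : ∀ a, ¬ ∃! b, T'.Adj (o a) b := h.not_existsUnique_adj_old
    (fun a ha => by
      obtain ⟨x, hx⟩ := J.exists_mem_hosts_of_isLeaf (R := R) hN ha
      exact ⟨x, (hc x).trans hx⟩)
    (fun x => by
      rw [hc]
      exact (J.leaf_of_mem_hosts _ _ x.2).exists)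
  refine ⟨⟨_, T', h.isTree J.isTree, fun v => {b | ∃ x : J.NewLeaf R N, x.1.2 = v ∧ b = n x},
    ?_, ?_, ?_⟩, o, n, c, ⟨h, hc, fun _ _ => Iff.rfl⟩, ?_⟩
  · rintro v b ⟨x, -, rfl⟩
    exact h.existsUnique_adj_new x
  · intro b hb
    rcases h.cover b with ⟨a, rfl⟩ | ⟨x, rfl⟩
    · exact (hold a hb).elim
    · refine ⟨x.1.2, ⟨x, rfl, rfl⟩, ?_⟩
      rintro v ⟨y, rfl, hy⟩
      rw [h.new_injective hy]
  · intro v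
    obtain ⟨l, hl⟩ := J.hosts_nonempty v.base
    exact ⟨_, ⟨(l, v), hl⟩, rfl, rfl⟩
  · have h1 : Nat.card (J.NewLeaf R N) ≤ Nat.card (Fin J.size × NWorldVar R N) :=
      Nat.card_le_card_of_injective _ Subtype.val_injective
    rw [Nat.card_prod, Nat.card_fin] at h1
    change Nat.card (Fin J.size ⊕ J.NewLeaf R N) ≤ _
    rw [Nat.card_sum, Nat.card_fin, mul_add, mul_one]
    omega

/-- Cutting the only edge at a leaf leaves nothing but its own family on that side. -/
theorem sep_subset_family_of_isLeaf (J : G.Jointree) {a b : Fin J.size} {X : V}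
    (hX : a ∈ J.hosts X) : J.sep s(a, b) ⊆ G.family X := by
  rintro Y ⟨hab, hY⟩
  obtain ⟨l, Z, hl, hZ, hYZ⟩ := hY a (Sym2.mem_mk_left _ _)
  have hleaf := J.leaf_of_mem_hosts _ _ hX
  have hla : l = a := by
    rw [SimpleGraph.reachable_iff_reflTransGen] at hl
    rcases Relation.ReflTransGen.cases_head hl with rfl | ⟨d, had, -⟩
    · rfl
    · rw [SimpleGraph.deleteEdges_adj] at had
      exact (had.2 (by rw [hleaf.unique had.1 hab]; rfl)).elim
  subst hla
  rwa [(J.existsUnique_of_leaf _ hleaf).unique hX hZ]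

theorem rule1_congr {J : G.Jointree} {S S' : Sym2 (Fin J.size) → Set V} {X : V}
    {e : Sym2 (Fin J.size)} (h : ∀ e, X ∈ S e → X ∈ S' e) (hr : J.Rule1 S X e) :
    J.Rule1 S' X e := by
  obtain ⟨l, hl, r, hr, p, hp, he, hS⟩ := hr
  exact ⟨l, hl, r, hr, p, hp, he, fun e' he' => h _ (hS e' he')⟩

theorem rule2_congr {J : G.Jointree} {S S' : Sym2 (Fin J.size) → Set V} {X : V}
    {e : Sym2 (Fin J.size)} (h : ∀ e, X ∈ S' e → X ∈ S e) (hr : J.Rule2 S X e) :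
    J.Rule2 S' X e := by
  obtain ⟨i, hi, hl, hS⟩ := hr
  exact ⟨i, hi, hl, fun k hk hne hX => hS k hk hne (h _ hX)⟩

/-- Several functional variables that may be removed from a separator can be removed one after the
other. -/
theorem reflTransGen_thinStep_diff {J : G.Jointree} {F : Set V} {S : Sym2 (Fin J.size) → Set V}
    {e : Sym2 (Fin J.size)} (he : e ∈ J.tree.edgeSet) (C : Set V) (hfin : C.Finite) (hF : C ⊆ F)
    (hS : C ⊆ S e) (hr : ∀ X ∈ C, J.Rule1 S X e ∨ J.Rule2 S X e) :
    Relation.ReflTransGen (J.ThinStep F) S (Function.update S e (S e \ C)) := by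
  induction C, hfin using Set.Finite.induction_on with
  | empty => simpa using Relation.ReflTransGen.refl
  | @insert X C hX _ ih =>
    refine (ih ((Set.subset_insert _ _).trans hF) ((Set.subset_insert _ _).trans hS)
      (fun Y hY => hr Y (Set.mem_insert_of_mem _ hY))).tail ?_
    -- Both rules for `X` only ask which separators contain `X`, and removing other variables does
    -- not affect that.
    have hiff : ∀ e', X ∈ Function.update S e (S e \ C) e' ↔ X ∈ S e' := by
      intro e'
      by_cases h : e' = e
      · subst h
        simp [hX]
      · rw [Function.update_of_ne h]
    refine ⟨X, hF (Set.mem_insert _ _), e, he, (hiff e).2 (hS (Set.mem_insert _ _)),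
      (hr X (Set.mem_insert _ _)).imp (rule1_congr fun e' => (hiff e').2)
        (rule2_congr fun e' => (hiff e').1), ?_⟩
    rw [Function.update_idem, Function.update_self, Set.sdiff_sdiff, Set.union_singleton]

theorem thinStep_lt {J : G.Jointree} {F : Set V} {S S' : Sym2 (Fin J.size) → Set V}
    (h : J.ThinStep F S S') : S' < S := by
  obtain ⟨X, -, e, -, hX, -, rfl⟩ := h
  rw [update_lt_self_iff]
  exact Set.sdiff_singleton_ssubset.2 hX

theorem thinStep_le {J : G.Jointree} {F : Set V} {S S' : Sym2 (Fin J.size) → Set V}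
    (h : Relation.ReflTransGen (J.ThinStep F) S S') : S' ≤ S := by
  induction h with
  | refl => exact le_rfl
  | tail _ hs ih => exact (thinStep_lt hs).le.trans ih

theorem exists_thinned [Finite V] {J : G.Jointree} {F : Set V} (S : Sym2 (Fin J.size) → Set V) :
    ∃ S', Relation.ReflTransGen (J.ThinStep F) S S' ∧ ∀ T, ¬ J.ThinStep F S' T := by
  induction S using WellFoundedLT.induction with
  | ind S ih =>
    by_cases h : ∃ T, J.ThinStep F S T
    · obtain ⟨T, hT⟩ := h
      obtain ⟨S', hS', hmax⟩ := ih T (thinStep_lt hT)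
      exact ⟨S', hS'.head hT, hmax⟩
    · exact ⟨S, .refl, not_exists.1 h⟩

/-! ### Mirroring a thinning and bounding the clusters. -/

namespace IsNWorldExtension

variable {J : G.Jointree} {J' : (G.nWorld R N).Jointree} {o : Fin J.size → Fin J'.size}
  {n : J.NewLeaf R N → Fin J'.size} {c : Fin J'.size → Fin J.size}

theorem isLeaf_of_new (h : J.IsNWorldExtension J' o n c) (x : J.NewLeaf R N) :
    J.IsLeaf (c (n x)) := by
  rw [h.collapse_new]
  exact J.leaf_of_mem_hosts _ _ x.2

theorem not_isLeaf_old (h : J.IsNWorldExtension J' o n c) (hN : 1 ≤ N) (a : Fin J.size) :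
    ¬ J'.IsLeaf (o a) := by
  refine h.toIsLeafExtension.not_existsUnique_adj_old (fun a ha => ?_)
    (fun x => (h.isLeaf_of_new x).exists) a
  obtain ⟨x, hx⟩ := J.exists_mem_hosts_of_isLeaf (R := R) hN ha
  exact ⟨x, (h.collapse_new x).trans hx⟩

/-- The two sides of an old edge collapse to the two sides of the original, and beside each host of
`X` all copies of `X` have their families hosted. -/
theorem sep_old (h : J.IsNWorldExtension J' o n c) (hN : 1 ≤ N) (hR : ∀ X ∈ R, G.IsRoot X)
    (e : Sym2 (Fin J.size)) : J'.sep (e.map o) = NWorldVar.base ⁻¹' J.sep e := by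
  ext v
  refine and_congr (h.map_mem_edgeSet e) ⟨fun H i hi => ?_, fun H i hi => ?_⟩
  · obtain ⟨l, u, hl, hu, hv⟩ := H (o i) (Sym2.mem_map.2 ⟨i, hi, rfl⟩)
    obtain ⟨x, rfl, rfl⟩ := (h.mem_hosts_iff _ _).1 hu
    have := h.reachable_collapse hl
    rw [h.collapse_old, h.collapse_new] at this
    exact ⟨x.1.1, _, this, x.2, base_mem_family hv⟩
  · obtain ⟨i, hie, rfl⟩ := Sym2.mem_map.1 hi
    obtain ⟨l, X, hl, hX, hv⟩ := H i hie
    obtain ⟨u, rfl, hu⟩ := exists_mem_family_of_base hN hR hv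
    refine ⟨n ⟨(l, u), hX⟩, u, ?_, (h.mem_hosts_iff _ _).2 ⟨_, rfl, rfl⟩, hu⟩
    have := h.reachable_new e ⟨(l, u), hX⟩
    rw [h.collapse_new] at this
    exact (h.reachable_old hl).trans this

theorem sep_new_subset (h : J.IsNWorldExtension J' o n c) (x : J.NewLeaf R N) (b : Fin J'.size) :
    J'.sep s(n x, b) ⊆ (G.nWorld R N).family x.1.2 :=
  J'.sep_subset_family_of_isLeaf ((h.mem_hosts_iff _ _).2 ⟨x, rfl, rfl⟩)

/-- A variable whose family is hosted at two new leaves is in the separators of both. -/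
theorem mem_sep_new (h : J.IsNWorldExtension J' o n c) {x y : J.NewLeaf R N} (hxy : x ≠ y)
    (hv : x.1.2 = y.1.2) : x.1.2 ∈ J'.sep s(n x, o (c (n x))) := by
  refine ⟨h.adj_new_old x, fun i hi => ?_⟩
  rcases Sym2.mem_iff.1 hi with rfl | rfl
  · exact ⟨n x, x.1.2, .rfl, (h.mem_hosts_iff _ _).2 ⟨x, rfl, rfl⟩, Or.inl rfl⟩
  · refine ⟨n y, x.1.2, (h.reachable_old_of_new J.isTree.connected x _ (c (n y))).trans ?_,
      (h.mem_hosts_iff _ _).2 ⟨y, hv.symm, rfl⟩, Or.inl rfl⟩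
    refine SimpleGraph.Adj.reachable
      (SimpleGraph.deleteEdges_adj.2 ⟨(h.adj_new_old y).symm, fun he => ?_⟩)
    rw [Set.mem_singleton_iff, Sym2.eq_iff] at he
    rcases he with ⟨h1, -⟩ | ⟨-, h1⟩
    · exact h.old_ne_new _ _ h1
    · exact hxy (h.new_injective h1).symm

/-- The path is prolonged at both ends to the new leaves for `v`. The two added separators contain
`v` because both leaves host its family and, by `hnew`, they have not been thinned. -/
theorem rule1 (h : J.IsNWorldExtension J' o n c)
    {S : Sym2 (Fin J.size) → Set V} {S' : Sym2 (Fin J'.size) → Set (NWorldVar R N)}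
    (hold : ∀ e, S' (e.map o) = NWorldVar.base ⁻¹' S e)
    (hnew : ∀ x, S' s(n x, o (c (n x))) = J'.sep s(n x, o (c (n x))))
    {v : NWorldVar R N} {e : Sym2 (Fin J.size)} (hr : J.Rule1 S v.base e) :
    J'.Rule1 S' v (e.map o) := by
  obtain ⟨l, hl, r, hr, p, hp, he, hS⟩ := hr
  -- The path contains `e`, so it is not trivial.
  have hne : l ≠ r := by
    rintro rfl
    rw [(SimpleGraph.Walk.isPath_iff_nil.1 hp).eq_nil] at he
    simp at he
  let x : J.NewLeaf R N := ⟨(l, v), hl⟩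
  let y : J.NewLeaf R N := ⟨(r, v), hr⟩
  have hxy : x ≠ y := fun hxy => hne (congrArg (fun z => z.1.1) hxy)
  obtain ⟨q, hq, hqe⟩ := h.exists_isPath_new hxy
    (p := p.copy (h.collapse_new x).symm (h.collapse_new y).symm) (by simpa using hp)
  refine ⟨n x, (h.mem_hosts_iff _ _).2 ⟨x, rfl, rfl⟩, n y, (h.mem_hosts_iff _ _).2 ⟨y, rfl, rfl⟩,
    q, hq, (hqe _).2 (Or.inr (Or.inl ⟨e, by simpa using he, rfl⟩)), fun e' he' => ?_⟩
  rcases (hqe _).1 he' with rfl | ⟨e', hep, rfl⟩ | rfl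
  · rw [hnew]
    exact h.mem_sep_new hxy rfl
  · rw [hold]
    exact hS e' (by simpa using hep)
  · rw [hnew]
    exact h.mem_sep_new hxy.symm rfl

/-- The node `i` is internal in `J`, so no new leaf is attached to it and its separators are all
old. -/
theorem rule2 (h : J.IsNWorldExtension J' o n c) (hN : 1 ≤ N)
    {S : Sym2 (Fin J.size) → Set V} {S' : Sym2 (Fin J'.size) → Set (NWorldVar R N)}
    (hold : ∀ e, S' (e.map o) = NWorldVar.base ⁻¹' S e)
    {v : NWorldVar R N} {e : Sym2 (Fin J.size)} (hr : J.Rule2 S v.base e) :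
    J'.Rule2 S' v (e.map o) := by
  obtain ⟨i, hi, hleaf, hS⟩ := hr
  refine ⟨o i, Sym2.mem_map.2 ⟨i, hi, rfl⟩, h.not_isLeaf_old hN i, fun k hk hne => ?_⟩
  rcases h.edge_cases hk with ⟨i', k', hi', rfl, hadj⟩ | ⟨x, hx, -⟩ | ⟨x, -, hx⟩
  · obtain rfl := h.old_injective hi'
    have := hS k' hadj (fun he => hne (by rw [← he, Sym2.map_mk]))
    rw [← Sym2.map_mk, hold]
    exact this
  · exact (h.old_ne_new _ _ hx).elim
  · rw [h.old_injective hx] at hleaf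
    exact (hleaf (h.isLeaf_of_new x)).elim

/-- A thinning of `J` is mirrored on the old edges of `J'`. -/
theorem exists_mirror [Finite V] (h : J.IsNWorldExtension J' o n c) (hN : 1 ≤ N)
    (hR : ∀ X ∈ R, G.IsRoot X) {F : Set V} {S : Sym2 (Fin J.size) → Set V}
    (hS : Relation.ReflTransGen (J.ThinStep F) J.sep S) :
    ∃ S', Relation.ReflTransGen (J'.ThinStep {v | v.base ∈ F}) J'.sep S' ∧
      (∀ e, S' (e.map o) = NWorldVar.base ⁻¹' S e) ∧
      ∀ x, S' s(n x, o (c (n x))) = J'.sep s(n x, o (c (n x))) := by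
  induction hS with
  | refl => exact ⟨J'.sep, .refl, h.sep_old hN hR, fun _ => rfl⟩
  | tail _ hstep ih =>
    obtain ⟨S', hS', hold, hnew⟩ := ih
    obtain ⟨X, hXF, e, he, hXe, hr, rfl⟩ := hstep
    -- One removal of `X` is matched by removing the whole fibre over `X`, one copy at a time.
    refine ⟨_, hS'.trans (reflTransGen_thinStep_diff ((h.map_mem_edgeSet e).2 he)
      (NWorldVar.base ⁻¹' {X}) (Set.toFinite _) ?_ ?_ ?_), fun e' => ?_, fun x => ?_⟩
    · rintro v rfl
      exact hXF
    · rintro v rfl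
      rw [hold]
      exact hXe
    · rintro v rfl
      exact hr.imp (h.rule1 hold hnew) (h.rule2 hN hold)
    · by_cases hee : e' = e
      · subst hee
        rw [Function.update_self, Function.update_self, hold, Set.preimage_sdiff]
      · rw [Function.update_of_ne hee, Function.update_of_ne (h.map_injective.ne hee), hold]
    · rw [Function.update_of_ne (h.map_ne_new e x _).symm, hnew]

/-- The delicate nodes are former leaves, now internal: the separators around them, old and new, all
lie over the family once hosted there. Inclusion in `hold` suffices, so further thinning is
harmless. -/
theorem cluster_subset (h : J.IsNWorldExtension J' o n c)
    {S : Sym2 (Fin J.size) → Set V} {S' : Sym2 (Fin J'.size) → Set (NWorldVar R N)}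
    (hS : S ≤ J.sep) (hS' : S' ≤ J'.sep) (hold : ∀ e, S' (e.map o) ⊆ NWorldVar.base ⁻¹' S e)
    (b : Fin J'.size) : J'.cluster S' b ⊆ NWorldVar.base ⁻¹' J.cluster S (c b) := by
  have hleaf : ∀ x : J.NewLeaf R N, (G.nWorld R N).family x.1.2 ⊆
      NWorldVar.base ⁻¹' J.cluster S (c (n x)) := by
    intro x v hv
    refine Or.inl ⟨h.isLeaf_of_new x, x.1.2.base, ?_, base_mem_family hv⟩
    rw [h.collapse_new]
    exact x.2
  rintro v (⟨-, u, hu, hv⟩ | ⟨hb, d, hd, hv⟩)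
  · obtain ⟨x, rfl, rfl⟩ := (h.mem_hosts_iff _ _).1 hu
    exact hleaf x hv
  · rcases h.edge_cases hd with ⟨a, d, rfl, rfl, hadj⟩ | ⟨x, rfl, -⟩ | ⟨x, rfl, rfl⟩
    · rw [h.collapse_old]
      have hv' : v.base ∈ S s(a, d) := hold _ hv
      by_cases ha : J.IsLeaf a
      · obtain ⟨X, hX, -⟩ := J.existsUnique_of_leaf a ha
        exact Or.inl ⟨ha, X, hX, J.sep_subset_family_of_isLeaf hX (hS _ hv')⟩
      · exact Or.inr ⟨ha, d, hadj, hv'⟩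
    · exact (hb (h.existsUnique_adj_new x)).elim
    · rw [h.collapse_old]
      rw [Sym2.eq_swap] at hv
      exact hleaf x (h.sep_new_subset x _ (hS' _ hv))

theorem width_le [Finite V] (h : J.IsNWorldExtension J' o n c) (hN : 1 ≤ N)
    {S : Sym2 (Fin J.size) → Set V} {S' : Sym2 (Fin J'.size) → Set (NWorldVar R N)}
    (hS : S ≤ J.sep) (hS' : S' ≤ J'.sep) (hold : ∀ e, S' (e.map o) ⊆ NWorldVar.base ⁻¹' S e) :
    J'.width S' ≤ N * (J.width S + 1) - 1 := by
  refine Nat.sub_le_sub_right (Finset.sup_le fun b _ => ?_) 1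
  calc (J'.cluster S' b).ncard
      ≤ _ := Set.ncard_le_ncard (h.cluster_subset hS hS' hold b)
    _ ≤ N * (J.cluster S (c b)).ncard := ncard_base_preimage_le hN _
    _ ≤ N * (J.width S + 1) := by
      have h1 := Finset.le_sup (f := fun i => (J.cluster S i).ncard) (Finset.mem_univ (c b))
      have h2 : J.width S = (Finset.univ.sup fun i => (J.cluster S i).ncard) - 1 := rfl
      gcongr
      omega

end IsNWorldExtension

/-- A thinned jointree of `G` yields a thinned jointree of the `N`-world network. -/
theorem exists_thinned_nWorld [Finite V] (J : G.Jointree) (hN : 1 ≤ N)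
    (hR : ∀ X ∈ R, G.IsRoot X) {F : Set V} {S : Sym2 (Fin J.size) → Set V} (hS : J.IsThinned F S) :
    ∃ (J' : (G.nWorld R N).Jointree) (S' : Sym2 (Fin J'.size) → Set (NWorldVar R N)),
      J'.IsThinned {v | v.base ∈ F} S' ∧ J'.size ≤ J.size * (1 + Nat.card (NWorldVar R N)) ∧
      J'.width S' ≤ N * (J.width S + 1) - 1 := by
  obtain ⟨J', o, n, c, h, hsize⟩ := J.exists_isNWorldExtension (R := R) hN
  obtain ⟨S₁, hS₁, hold, -⟩ := h.exists_mirror hN hR hS.1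
  -- The mirrored thinning need not be exhaustive, as the edges of the new leaves are untouched; it
  -- is continued to the end.
  obtain ⟨S', hS', hmax⟩ := exists_thinned (F := {v : NWorldVar R N | v.base ∈ F}) S₁
  refine ⟨J', S', ⟨hS₁.trans hS', hmax⟩, hsize, h.width_le hN (thinStep_le hS.1)
    (thinStep_le (hS₁.trans hS')) fun e => ?_⟩
  rw [← hold]
  exact thinStep_le hS' _

end Jointree

theorem causalTreewidth_nWorld_le [Finite V] (G : DAG V) (hN : 1 ≤ N) (hR : ∀ X ∈ R, G.IsRoot X)
    (F : Set V) {b b' : ℕ∞}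
    (hb : ∀ m m' : ℕ, (m : ℕ∞) ≤ b → m' ≤ m * (1 + Nat.card (NWorldVar R N)) → (m' : ℕ∞) ≤ b') :
    (G.nWorld R N).causalTreewidth {X | X.base ∈ F} b' ≤
      N * (G.causalTreewidth F b + 1) - 1 := by
  by_cases htop : G.causalTreewidth F b = ⊤
  · have hN0 : (N : ℕ∞) ≠ 0 := by exact_mod_cast (by omega : N ≠ 0)
    simp [htop, ENat.mul_top hN0]
  · have hlt : G.causalTreewidth F b < G.causalTreewidth F b + 1 :=
      ENat.lt_add_one_iff htop |>.2 le_rfl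
    rw [causalTreewidth] at hlt
    simp only [iInf_lt_iff] at hlt
    obtain ⟨J, S, hS, hsize, hw⟩ := hlt
    obtain ⟨J', S', hS', hsize', hw'⟩ := J.exists_thinned_nWorld hN hR hS
    calc (G.nWorld R N).causalTreewidth {X | X.base ∈ F} b'
        ≤ J'.width S' := iInf₂_le_of_le J' S' (iInf₂_le_of_le hS' (hb _ _ hsize hsize') le_rfl)
      _ ≤ ((N * (J.width S + 1) - 1 : ℕ) : ℕ∞) := by exact_mod_cast hw'
      _ = N * (J.width S + 1) - 1 := by push_cast; rfl
      _ ≤ N * (G.causalTreewidth F b + 1) - 1 := by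
        have := (ENat.lt_add_one_iff htop).1 hw
        gcongr

end DAG

theorem theorem4 :
    -- treewidth
    (∀ (N : ℕ), 1 ≤ N → ∀ (V : Type u) [Finite V] [Nonempty V] (G : DAG V) (R : Set V),
      (∀ X ∈ R, G.IsRoot X) →
        (G.nWorld R N).treewidth ≤ N * (G.treewidth + 1) - 1) ∧
    -- causal treewidth, jointrees of arbitrary size
    (∀ (N : ℕ), 1 ≤ N → ∀ (V : Type u) [Finite V] [Nonempty V] (G : DAG V) (R F : Set V),
      (∀ X ∈ R, G.IsRoot X) → Disjoint F R →
        (G.nWorld R N).causalTreewidth {X | X.base ∈ F} ⊤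
          ≤ N * (G.causalTreewidth F ⊤ + 1) - 1) ∧
    -- causal treewidth, jointrees of polynomial size
    (∀ p : Polynomial ℕ, ∃ q : Polynomial ℕ,
      ∀ (N : ℕ), 1 ≤ N → ∀ (V : Type u) [Finite V] [Nonempty V] (G : DAG V) (R F : Set V),
      (∀ X ∈ R, G.IsRoot X) → Disjoint F R →
        (G.nWorld R N).causalTreewidth {X | X.base ∈ F}
            (q.eval (Nat.card (DAG.NWorldVar R N)) : ℕ)
          ≤ N * (G.causalTreewidth F (p.eval (Nat.card V) : ℕ) + 1) - 1) := by
  refine ⟨fun N hN V _ _ G R _ => G.treewidth_nWorld_le hN,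
    fun N hN V _ _ G R F hR _ => G.causalTreewidth_nWorld_le hN hR F fun _ _ _ _ => le_top,
    -- The factor `1 + X` pays for the new leaves; natural coefficients make `p` monotone, so it may
    -- be evaluated at the larger network.
    fun p => ⟨p * (1 + Polynomial.X), fun N hN V _ _ G R F hR _ =>
      G.causalTreewidth_nWorld_le hN hR F fun m m' hm hm' => ?_⟩⟩
  have hcard : Nat.card V ≤ Nat.card (DAG.NWorldVar R N) :=
    Nat.card_le_card_of_surjective _ (DAG.base_surjective hN)
  have hp : p.eval (Nat.card V) ≤ p.eval (Nat.card (DAG.NWorldVar R N)) := by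
    rw [Polynomial.eval_eq_sum, Polynomial.eval_eq_sum]
    exact Finset.sum_le_sum fun i _ => Nat.mul_le_mul_left _ (Nat.pow_le_pow_left hcard i)
  have hm : m ≤ p.eval (Nat.card V) := by exact_mod_cast hm
  have : m' ≤ (p * (1 + Polynomial.X)).eval (Nat.card (DAG.NWorldVar R N)) := by
    rw [Polynomial.eval_mul, Polynomial.eval_add, Polynomial.eval_one, Polynomial.eval_X]
    exact hm'.trans (Nat.mul_le_mul_right _ (hm.trans hp))
  exact_mod_cast this
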